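/- Let $\mathbb D$ be the open unit disk, $\mathbb T=\partial\mathbb D$, let $\mu$ be a finite positive Borel measure on $\mathbb T$, and let $b$ be a holomorphic function on $\mathbb D$ with $\sup_{\mathbb D}|b|\le 1$ (that is, $b$ belongs to the closed unit ball of $H^\infty$; it may or may not be an extreme point of it). Let $T_b\colon H^2\to H^2$, $f\mapsto bf$, be the multiplication operator on the Hardy space of $\mathbb D$, let $H(b)=\operatorname{Ran}\,(I-T_bT_b^*)^{1/2}$ be the de Branges--Rovnyak space, and let $$\mathcal D_\mu=\Big\{f\in\operatorname{Hol}(\mathbb D)\colon \int_{\mathbb D}|f'(z)|^2P_\mu(z)\,dA(z)<\infty\Big\},\qquad P_\mu(z)=\int_{\mathbb T}\frac{1-|z|^2}{|z-\zeta|^2}\,d\mu(\zeta),$$ where $dA$ is area measure. Put $\sigma(b)=\{\zeta\in\mathbb T\colon \liminf_{z\to\zeta,\,z\in\mathbb D}|b(z)|<1\}$ and $V_\mu(z)=\int_{\mathbb T}|\lambda-z|^{-2}\,d\mu(\lambda)\in[0,+\infty]$, where $1/0=+\infty$. If $H(b)\subseteq\mathcal D_\mu$ (in particular, if $H(b)$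 embeds boundedly in $\mathcal D_\mu$), then $$V_\mu(\zeta)<\infty\ \text{ for every }\zeta\in\sigma(b),\qquad\text{and}\qquad \mu(\sigma(b))=0.$$ -/

import Mathlib

open Metric Filter Topology MeasureTheory
open scoped ENNReal

noncomputable section

namespace HardyDirichlet

/-! ## Taylor coefficients and circular means -/

/-- The `n`-th Taylor coefficient at the origin. -/
def coeff (f : ℂ → ℂ) (n : ℕ) : ℂ := iteratedDeriv n f 0 / (n.factorial : ℂ)

/-- The mean `∫_𝕋 |f(rζ)|² dm(ζ)`, where `m` is normalized Lebesgue measure on `𝕋`. -/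
def mean (f : ℂ → ℂ) (r : ℝ) : ℝ := Real.circleAverage (fun z => ‖f z‖ ^ 2) 0 r

theorem hasSum_coeff {f : ℂ → ℂ} (hf : DifferentiableOn ℂ f (ball 0 1)) {z : ℂ}
    (hz : z ∈ ball (0 : ℂ) 1) : HasSum (fun n => coeff f n * z ^ n) (f z) := by
  have h := Complex.hasSum_taylorSeries_on_ball hf hz
  have e : (fun n => coeff f n * z ^ n) =
      fun n => ((n.factorial : ℂ))⁻¹ • (z - 0) ^ n • iteratedDeriv n f 0 := by
    funext n
    simp only [coeff, smul_eq_mul, sub_zero]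
    ring
  rw [e]
  exact h

theorem hasSum_sq_circleAverage {c : ℕ → ℂ} (hc : Summable fun n => ‖c n‖) :
    Tendsto (fun N => ∑ n ∈ Finset.range N, ‖c n‖ ^ 2) atTop
      (𝓝 (Real.circleAverage (fun z => ‖∑' n, c n * z ^ n‖ ^ 2) 0 1)) := by
  have key : ∀ N, ∑ n ∈ Finset.range N, ‖c n‖ ^ 2 =
      Real.circleAverage (fun z => ‖∑ n ∈ Finset.range N, c n * z ^ n‖ ^ 2) 0 1 := by
    intro N
    set p : Polynomial ℂ := ∑ n ∈ Finset.range N, Polynomial.monomial n (c n) with hp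
    have hcoeff : ∀ n, p.coeff n = if n ∈ Finset.range N then c n else 0 := by
      intro n
      simp [hp, Polynomial.coeff_monomial]
    have h := Polynomial.sum_sq_norm_coeff_eq_circleAverage p
    have h2 : ∀ z, p.eval z = ∑ n ∈ Finset.range N, c n * z ^ n := by
      intro z; simp [hp, Polynomial.eval_finsetSum]
    simp only [h2] at h
    rw [← h]
    symm
    rw [Finset.sum_subset (s₂ := Finset.range N)]
    · exact Finset.sum_congr rfl fun n hn => by rw [hcoeff, if_pos hn]
    · intro n hn
      by_contra hnN
      simp [hcoeff] at hn
      simp at hnN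
      omega
    · intro n _ hn
      simp [Polynomial.notMem_support_iff.1 hn]
  simp only [key, Real.circleAverage_def]
  apply Tendsto.const_smul
  have hnorm : ∀ (θ : ℝ) n, ‖c n * circleMap 0 1 θ ^ n‖ = ‖c n‖ := by
    intro θ n; simp
  refine intervalIntegral.tendsto_integral_filter_of_dominated_convergence
    (fun _ => (∑' n, ‖c n‖) ^ 2) ?_ ?_ (by simp) ?_
  · refine Eventually.of_forall fun N => Continuous.aestronglyMeasurable ?_
    fun_prop
  · refine Eventually.of_forall fun N => Eventually.of_forall fun θ _ => ?_
    rw [norm_pow, norm_norm]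
    gcongr
    refine (norm_sum_le _ _).trans ?_
    simp only [hnorm]
    exact hc.sum_le_tsum _ fun _ _ => norm_nonneg _
  · refine Eventually.of_forall fun θ _ => ?_
    have hs : Summable fun n => c n * circleMap 0 1 θ ^ n := by
      apply Summable.of_norm
      simpa only [hnorm] using hc
    exact (hs.hasSum.tendsto_sum_nat.norm).pow 2

/-- Parseval's identity on the circle of radius `r`. -/
theorem hasSum_mean {f : ℂ → ℂ} (hf : DifferentiableOn ℂ f (ball 0 1)) {r : ℝ}
    (hr : r ∈ Set.Ioo (0 : ℝ) 1) :
    HasSum (fun n => ‖coeff f n‖ ^ 2 * r ^ (2 * n)) (mean f r) := by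
  have hr0 := hr.1.le
  have hball : ∀ z : ℂ, ‖z‖ = 1 → (r : ℂ) * z ∈ ball (0 : ℂ) 1 := by
    intro z hz; simp [hz, abs_of_pos hr.1, hr.2]
  have hc : Summable fun n => ‖coeff f n * (r : ℂ) ^ n‖ := by
    have := (hasSum_coeff hf (hball 1 (by simp))).summable.norm
    simpa using this
  have h := hasSum_sq_circleAverage hc
  have e : Real.circleAverage (fun z => ‖∑' n, coeff f n * (r : ℂ) ^ n * z ^ n‖ ^ 2) 0 1
      = mean f r := by
    rw [mean, Real.circleAverage_eq_circleAverage_zero_one (R := r)]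
    apply Real.circleAverage_congr_sphere
    intro z hz
    have hz1 : ‖z‖ = 1 := by simpa using hz
    simp only [add_zero]
    rw [← (hasSum_coeff hf (hball z hz1)).tsum_eq]
    simp only [mul_pow, mul_assoc]
  rw [e] at h
  rw [hasSum_iff_tendsto_nat_of_nonneg (fun n => by positivity)]
  refine h.congr fun N => Finset.sum_congr rfl fun n _ => ?_
  rw [norm_mul, mul_pow, norm_pow, Complex.norm_real, Real.norm_of_nonneg hr0, ← pow_mul,
    mul_comm n 2]

/-! ## The Hardy space `H²` as a Hilbert space -/

theorem sum_le_of_mean_le {f : ℂ → ℂ} (hf : DifferentiableOn ℂ f (ball 0 1)) {M : ℝ}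
    (hM : ∀ r ∈ Set.Ioo (0 : ℝ) 1, mean f r ≤ M) (s : Finset ℕ) :
    ∑ n ∈ s, ‖coeff f n‖ ^ 2 ≤ M := by
  have hl : Tendsto (fun r : ℝ => ∑ n ∈ s, ‖coeff f n‖ ^ 2 * r ^ (2 * n)) (𝓝[<] 1)
      (𝓝 (∑ n ∈ s, ‖coeff f n‖ ^ 2 * (1 : ℝ) ^ (2 * n))) := by
    apply Tendsto.mono_left _ nhdsWithin_le_nhds
    exact (by fun_prop : Continuous fun r : ℝ =>
      ∑ n ∈ s, ‖coeff f n‖ ^ 2 * r ^ (2 * n)).tendsto 1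
  simp only [one_pow, mul_one] at hl
  refine le_of_tendsto hl ?_
  filter_upwards [Ioo_mem_nhdsLT (zero_lt_one (α := ℝ))] with r hr
  refine le_trans ?_ (hM r hr)
  have hr0 := hr.1
  exact sum_le_hasSum s (fun n _ => by positivity) (hasSum_mean hf hr)

theorem mean_le_tsum {f : ℂ → ℂ} (hf : DifferentiableOn ℂ f (ball 0 1))
    (hs : Summable fun n => ‖coeff f n‖ ^ 2) {r : ℝ} (hr : r ∈ Set.Ioo (0 : ℝ) 1) :
    mean f r ≤ ∑' n, ‖coeff f n‖ ^ 2 := by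
  have hr0 := hr.1
  refine hasSum_le (fun n => ?_) (hasSum_mean hf hr) hs.hasSum
  exact mul_le_of_le_one_right (by positivity) (pow_le_one₀ hr0.le hr.2.le)

theorem memlp_iff {f : ℂ → ℂ} :
    Memℓp (coeff f) 2 ↔ Summable fun n => ‖coeff f n‖ ^ 2 := by
  rw [memℓp_gen_iff (by simp)]
  simp

theorem bddAbove_mean_iff {f : ℂ → ℂ} (hf : DifferentiableOn ℂ f (ball 0 1)) :
    BddAbove (mean f '' Set.Ioo 0 1) ↔ Memℓp (coeff f) 2 := by
  rw [memlp_iff]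
  constructor
  · rintro ⟨M, hM⟩
    exact summable_of_sum_le (fun n => by positivity)
      (sum_le_of_mean_le hf fun r hr => hM ⟨r, hr, rfl⟩)
  · intro hs
    refine ⟨∑' n, ‖coeff f n‖ ^ 2, ?_⟩
    rintro _ ⟨r, hr, rfl⟩
    exact mean_le_tsum hf hs hr

theorem contDiffAt_zero {f : ℂ → ℂ} (hf : DifferentiableOn ℂ f (ball 0 1)) (n : ℕ) :
    ContDiffAt ℂ n f 0 :=
  (hf.analyticAt (ball_mem_nhds 0 one_pos)).contDiffAt

theorem coeff_add {f g : ℂ → ℂ} (hf : DifferentiableOn ℂ f (ball 0 1))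
    (hg : DifferentiableOn ℂ g (ball 0 1)) : coeff (f + g) = coeff f + coeff g := by
  ext n
  simp [coeff, iteratedDeriv_add (contDiffAt_zero hf n) (contDiffAt_zero hg n), add_div]

theorem coeff_smul (a : ℂ) (f : ℂ → ℂ) : coeff (a • f) = a • coeff f := by
  ext n
  simp only [coeff, iteratedDeriv_const_smul_field, Pi.smul_apply, smul_eq_mul]
  ring

theorem coeff_zero : coeff 0 = 0 := by
  simpa using coeff_smul 0 0

/-- The holomorphic functions on the open unit disk whose circular means are bounded. A function
on the disk is represented by its extension by zero to `ℂ`, so that two elements are equal exactly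
when they agree on the disk. -/
def hardySubmodule : Submodule ℂ (ℂ → ℂ) where
  carrier := {f | DifferentiableOn ℂ f (ball 0 1) ∧ (∀ z ∉ ball (0 : ℂ) 1, f z = 0) ∧
    BddAbove (mean f '' Set.Ioo 0 1)}
  add_mem' := by
    rintro f g ⟨hf, hf0, hfb⟩ ⟨hg, hg0, hgb⟩
    refine ⟨hf.add hg, fun z hz => by simp [hf0 z hz, hg0 z hz], ?_⟩
    rw [bddAbove_mean_iff hf] at hfb
    rw [bddAbove_mean_iff hg] at hgb
    rw [bddAbove_mean_iff (hf.add hg), coeff_add hf hg]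
    exact hfb.add hgb
  zero_mem' := by
    have h0 : DifferentiableOn ℂ (0 : ℂ → ℂ) (ball 0 1) := differentiableOn_const 0
    refine ⟨h0, fun z _ => rfl, ?_⟩
    rw [bddAbove_mean_iff h0, coeff_zero]
    exact zero_memℓp
  smul_mem' := by
    rintro a f ⟨hf, hf0, hfb⟩
    refine ⟨hf.const_smul a, fun z hz => by simp [hf0 z hz], ?_⟩
    rw [bddAbove_mean_iff hf] at hfb
    rw [bddAbove_mean_iff (hf.const_smul a), coeff_smul]
    exact hfb.const_smul a

/-- The Hardy space `H²` of the unit disk. -/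
def HardySpace : Type := hardySubmodule

namespace HardySpace

/-- The underlying function; it vanishes off the disk. -/
def toFun (f : HardySpace) : ℂ → ℂ := f.1

theorem differentiableOn (f : HardySpace) : DifferentiableOn ℂ f.toFun (ball 0 1) := f.2.1

theorem toFun_injective : Function.Injective toFun := Subtype.val_injective

/-- The Taylor coefficients of a function in `H²`, as a square-summable sequence. -/
def coeffMap : hardySubmodule →ₗ[ℂ] lp (fun _ : ℕ => ℂ) 2 where
  toFun f := ⟨coeff f.1, (bddAbove_mean_iff f.2.1).1 f.2.2.2⟩
  map_add' f g := Subtype.ext (coeff_add f.2.1 g.2.1)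
  map_smul' a f := Subtype.ext (coeff_smul a f.1)

theorem coeffMap_injective : Function.Injective coeffMap := by
  intro f g h
  have hc : coeff f.1 = coeff g.1 := congrArg Subtype.val h
  apply Subtype.ext
  funext z
  by_cases hz : z ∈ ball (0 : ℂ) 1
  · have h1 := hasSum_coeff f.2.1 hz
    have h2 := hasSum_coeff g.2.1 hz
    rw [hc] at h1
    exact h1.unique h2
  · exact (f.2.2.1 z hz).trans (g.2.2.1 z hz).symm

theorem coeffMap_surjective : Function.Surjective coeffMap := by
  intro a
  set p : FormalMultilinearSeries ℂ ℂ ℂ := FormalMultilinearSeries.ofScalars ℂ (a : ℕ → ℂ) with hp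
  have hrad : (1 : ENNReal) ≤ p.radius := by
    refine p.le_radius_of_bound (r := 1) ‖a‖ fun n => ?_
    simp only [NNReal.coe_one, one_pow, mul_one, hp, FormalMultilinearSeries.ofScalars_norm]
    exact lp.norm_apply_le_norm (by simp) a n
  have hpow : HasFPowerSeriesOnBall p.sum p 0 1 :=
    (p.hasFPowerSeriesOnBall (lt_of_lt_of_le one_pos hrad)).mono one_pos hrad
  set f : ℂ → ℂ := (ball (0 : ℂ) 1).indicator p.sum with hf
  have hfpow : HasFPowerSeriesOnBall f p 0 1 := by
    refine hpow.congr fun z hz => ?_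
    have hz' : z ∈ ball (0 : ℂ) 1 := by
      simpa [← Metric.eball_ofReal] using hz
    rw [hf, Set.indicator_of_mem hz']
  have hdiff : DifferentiableOn ℂ f (ball 0 1) := by
    intro z hz
    refine (hfpow.analyticAt_of_mem ?_).differentiableAt.differentiableWithinAt
    simpa [← Metric.eball_ofReal] using hz
  have hco : coeff f = a := by
    have h1 := (hdiff.analyticAt (ball_mem_nhds 0 one_pos)).hasFPowerSeriesAt
    have h2 := h1.eq_formalMultilinearSeries hfpow.hasFPowerSeriesAt
    exact FormalMultilinearSeries.ofScalars_series_injective ℂ ℂ h2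
  refine ⟨⟨f, hdiff, fun z hz => Set.indicator_of_notMem hz _, ?_⟩, Subtype.ext hco⟩
  rw [bddAbove_mean_iff hdiff, hco]
  exact a.2

instance : NormedAddCommGroup HardySpace :=
  NormedAddCommGroup.induced hardySubmodule (lp (fun _ : ℕ => ℂ) 2) coeffMap coeffMap_injective

theorem norm_eq (f : HardySpace) : ‖f‖ = ‖coeffMap f‖ := rfl

/-- The inner product `⟪f, g⟫ = ∑ conj (aₙ) bₙ` (conjugate-linear in the first variable); its norm
is the `H²` norm by `norm_sq_eq_sSup_mean`. -/
instance : InnerProductSpace ℂ HardySpace where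
  toModule := inferInstanceAs (Module ℂ hardySubmodule)
  norm_smul_le a f := by
    change ‖coeffMap (a • (show hardySubmodule from f))‖ ≤ ‖a‖ * ‖coeffMap f‖
    rw [map_smul]
    exact norm_smul_le _ _
  inner f g := inner ℂ (coeffMap f) (coeffMap g)
  norm_sq_eq_re_inner f := norm_sq_eq_re_inner (𝕜 := ℂ) (coeffMap f)
  conj_inner_symm f g := inner_conj_symm (𝕜 := ℂ) (coeffMap f) (coeffMap g)
  add_left f g h := by
    change inner ℂ (coeffMap ((show hardySubmodule from f) + (show hardySubmodule from g)))
      (coeffMap h) = _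
    rw [map_add]
    exact inner_add_left _ _ _
  smul_left f g a := by
    change inner ℂ (coeffMap (a • (show hardySubmodule from f))) (coeffMap g) = _
    rw [map_smul]
    exact inner_smul_left _ _ _

theorem toFun_add (f g : HardySpace) : (f + g).toFun = f.toFun + g.toFun := rfl

theorem toFun_smul (a : ℂ) (f : HardySpace) : (a • f).toFun = a • f.toFun := rfl

/-- Taylor coefficients identify `H²` isometrically with `ℓ²`. -/
def coeffIso : HardySpace ≃ₗᵢ[ℂ] lp (fun _ : ℕ => ℂ) 2 where
  toLinearEquiv := LinearEquiv.ofBijective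
    { toFun := fun f => coeffMap f
      map_add' := fun f g => coeffMap.map_add f g
      map_smul' := fun a f => coeffMap.map_smul a f } ⟨coeffMap_injective, coeffMap_surjective⟩
  norm_map' _ := rfl

instance : CompleteSpace HardySpace :=
  (completeSpace_congr (e := coeffIso.toEquiv)
    coeffIso.isometry.isUniformInducing.isUniformEmbedding).2 inferInstance

theorem norm_sq_eq_tsum (f : HardySpace) : ‖f‖ ^ 2 = ∑' n, ‖coeff f.toFun n‖ ^ 2 := by
  have h := lp.norm_rpow_eq_tsum (p := 2) (by simp) (coeffMap f)
  simp only [ENNReal.toReal_ofNat, Real.rpow_two] at h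
  exact h

/-- `‖f‖² = sup_{0<r<1} ∫_𝕋 |f(rζ)|² dm(ζ)`. -/
theorem norm_sq_eq_sSup_mean (f : HardySpace) : ‖f‖ ^ 2 = sSup (mean f.toFun '' Set.Ioo 0 1) := by
  have hs := memlp_iff.1 ((bddAbove_mean_iff f.2.1).1 f.2.2.2)
  rw [norm_sq_eq_tsum]
  apply le_antisymm
  · exact Real.tsum_le_of_sum_le (fun n => by positivity)
      (sum_le_of_mean_le f.2.1 fun r hr => le_csSup f.2.2.2 ⟨r, hr, rfl⟩)
  · refine csSup_le (Set.Nonempty.image _ ⟨1 / 2, by norm_num, by norm_num⟩) ?_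
    rintro _ ⟨r, hr, rfl⟩
    exact mean_le_tsum f.2.1 hs hr

end HardySpace

/-! ## Multiplication operators and de Branges–Rovnyak spaces -/

/-- The closed unit ball of `H^∞`: `b` is holomorphic on the unit disk and bounded there by `1`
(values off the disk play no role). -/
structure InUnitBall (b : ℂ → ℂ) : Prop where
  differentiableOn : DifferentiableOn ℂ b (ball 0 1)
  norm_le_one : ∀ z ∈ ball (0 : ℂ) 1, ‖b z‖ ≤ 1

theorem continuous_comp_circleMap {f : ℂ → ℂ} (hf : DifferentiableOn ℂ f (ball 0 1)) {r : ℝ}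
    (hr : r ∈ Set.Ioo (0 : ℝ) 1) : Continuous fun θ => f (circleMap 0 r θ) := by
  refine hf.continuousOn.comp_continuous (continuous_circleMap 0 r) fun θ => ?_
  simp [abs_of_pos hr.1, hr.2]

theorem mean_mul_le {b f : ℂ → ℂ} (hb : InUnitBall b) (hf : DifferentiableOn ℂ f (ball 0 1))
    {r : ℝ} (hr : r ∈ Set.Ioo (0 : ℝ) 1) : mean (fun z => b z * f z) r ≤ mean f r := by
  apply Real.circleAverage_mono
  · exact (((continuous_comp_circleMap (hb.1.mul hf) hr).norm.pow 2)).intervalIntegrable _ _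
  · exact (((continuous_comp_circleMap hf hr).norm.pow 2)).intervalIntegrable _ _
  · intro z hz
    have hz1 : z ∈ ball (0 : ℂ) 1 := by
      have : ‖z‖ = r := by simpa [abs_of_pos hr.1] using hz
      simp [this, hr.2]
    simp only [norm_mul]
    gcongr
    exact mul_le_of_le_one_left (norm_nonneg _) (hb.2 z hz1)

/-- The multiplication operator `T_b : f ↦ bf` on `H²`. -/
def mulOp (b : ℂ → ℂ) (hb : InUnitBall b) : HardySpace →L[ℂ] HardySpace :=
  LinearMap.mkContinuous
    { toFun := fun f => ⟨fun z => b z * f.toFun z, hb.1.mul f.2.1,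
        fun z hz => by
          change b z * f.1 z = 0
          rw [f.2.2.1 z hz, mul_zero],
        by
          obtain ⟨M, hM⟩ := f.2.2.2
          refine ⟨M, ?_⟩
          rintro _ ⟨r, hr, rfl⟩
          exact (mean_mul_le hb f.2.1 hr).trans (hM ⟨r, hr, rfl⟩)⟩
      map_add' := fun f g => Subtype.ext (funext fun z => mul_add _ _ _)
      map_smul' := fun a f => Subtype.ext (funext fun z => mul_left_comm _ _ _) }
    1 (by
      intro f
      rw [one_mul, ← sq_le_sq₀ (norm_nonneg _) (norm_nonneg _),
        HardySpace.norm_sq_eq_sSup_mean, HardySpace.norm_sq_eq_sSup_mean]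
      refine csSup_le (Set.Nonempty.image _ ⟨1 / 2, by norm_num, by norm_num⟩) ?_
      rintro _ ⟨r, hr, rfl⟩
      exact (mean_mul_le hb f.2.1 hr).trans (le_csSup f.2.2.2 ⟨r, hr, rfl⟩))

theorem mulOp_apply (b : ℂ → ℂ) (hb : InUnitBall b) (f : HardySpace) (z : ℂ) :
    (mulOp b hb f).toFun z = b z * f.toFun z := rfl

theorem norm_mulOp_le (b : ℂ → ℂ) (hb : InUnitBall b) : ‖mulOp b hb‖ ≤ 1 :=
  LinearMap.mkContinuous_norm_le _ zero_le_one _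

/-- The defect operator `I - T_b T_b^*`. -/
def defect (b : ℂ → ℂ) (hb : InUnitBall b) : HardySpace →L[ℂ] HardySpace :=
  1 - mulOp b hb * ContinuousLinearMap.adjoint (mulOp b hb)

theorem defect_nonneg (b : ℂ → ℂ) (hb : InUnitBall b) : 0 ≤ defect b hb := by
  have hT := norm_mulOp_le b hb
  rw [defect, sub_nonneg, ← ContinuousLinearMap.star_eq_adjoint,
    ← CStarAlgebra.norm_le_one_iff_of_nonneg _ (mul_star_self_nonneg _),
    CStarRing.norm_self_mul_star]
  exact mul_le_one₀ hT (norm_nonneg _) hT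

/-- The de Branges–Rovnyak space `H(b)`: the functions in the range of `(I - T_b T_b^*)^{1/2}`. -/
def deBrangesRovnyak (b : ℂ → ℂ) (hb : InUnitBall b) : Set (ℂ → ℂ) :=
  Set.range fun g : HardySpace => (CFC.sqrt (defect b hb) g).toFun

/-! ## Harmonically weighted Dirichlet spaces, potentials and boundary spectra -/

/-- The Poisson integral `P_μ(z) = ∫_𝕋 (1 - |z|²) / |z - ζ|² dμ(ζ)`, for `z` in the disk. -/
def poissonIntegral (μ : Measure (sphere (0 : ℂ) 1)) (z : ℂ) : ℝ≥0∞ :=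
  ∫⁻ ζ, ENNReal.ofReal ((1 - ‖z‖ ^ 2) / ‖z - ζ‖ ^ 2) ∂μ

/-- The weighted Dirichlet integral `∫_𝔻 |f'|² P_μ dA`, `dA` being area measure. -/
def dirichletIntegral (μ : Measure (sphere (0 : ℂ) 1)) (f : ℂ → ℂ) : ℝ≥0∞ :=
  ∫⁻ z in ball (0 : ℂ) 1, ‖deriv f z‖ₑ ^ 2 * poissonIntegral μ z

/-- The space `𝒟_μ` of holomorphic functions on the disk with finite weighted Dirichlet integral
(values off the disk play no role). -/
def dirichletSpace (μ : Measure (sphere (0 : ℂ) 1)) : Set (ℂ → ℂ) :=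
  {f | DifferentiableOn ℂ f (ball 0 1) ∧ dirichletIntegral μ f < ∞}

/-- The potential `V_μ(z) = ∫_𝕋 |ζ - z|⁻² dμ(ζ) ∈ [0, ∞]`, where `0⁻¹ = ∞`. -/
def potential (μ : Measure (sphere (0 : ℂ) 1)) (z : ℂ) : ℝ≥0∞ :=
  ∫⁻ ζ : sphere (0 : ℂ) 1, (‖(ζ : ℂ) - z‖ₑ ^ 2)⁻¹ ∂μ

/-- The boundary spectrum `σ(b)`: the points `ζ ∈ 𝕋` with `liminf |b(z)| < 1` as `z → ζ` from
within the disk. -/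
def boundarySpectrum (b : ℂ → ℂ) : Set (sphere (0 : ℂ) 1) :=
  {ζ | liminf (fun z => ‖b z‖ₑ) (𝓝[ball 0 1] (ζ : ℂ)) < 1}

end HardyDirichlet

end

namespace HardyDirichlet

/-! The inclusion is automatically bounded: `f ↦ (I - T_b T_b^*)^{1/2} f` satisfies a Dirichlet
bound `C‖f‖²` (`exists_dirichletIntegral_le`). It is tested on `(I - T_b T_b^*)^{1/2} k_w`, with
`k_w` the Szegő kernel. The image is the reproducing kernel `K_w` of `H(b)`, so its Dirichlet
integral is at most a constant times `(1 - |b(w)|²) / (1 - |w|²) ≤ 1/δ`, where `δ = 1 - |w|`.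

Suppose `1 - |b(w)|² ≥ ε`. Then `K_w(w)` is of order `ε/δ`, but `K_w` is at most half its lower
bound there at a point of the same radius at distance `O(δ/ε)`. So `|K_w'|` is at least of order
`ε²/δ²` at some `z` near `w` (`exists_le_norm_deriv_defect_szego`). On the disk of radius `δ/2`
about `z`, `P_μ` dominates a multiple of `δ V_μ(w)`, and the sub-mean value property of `|K_w'|²`
bounds the Dirichlet integral below by a multiple of `δ² · δ⁻⁴ · δ V_μ(w) = V_μ(w)/δ`. The powers of
`δ` cancel, so `V_μ(w)` is bounded uniformly in such `w` near the circle (`exists_potential_le`),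
and Fatou carries the bound to `σ(b)`.

Finally, finiteness of `V_μ` on a subset of the circle already makes it `μ`-null: an arc of length
`1/N` meeting `{V_μ ≤ n}` has mass at most `n/N²`, and `O(N)` such arcs cover the circle. -/

/-! ### Mean values over circles and disks -/

theorem enorm_mul_two_pi_le_lintegral_circleMap {g : ℂ → ℂ} {c : ℂ} {r ρ : ℝ}
    (hg : DifferentiableOn ℂ g (ball c r)) (hρ : 0 < ρ) (hρr : ρ < r) :
    ‖g c‖ₑ * ENNReal.ofReal (2 * Real.pi) ≤
      ∫⁻ θ in Set.Ioo (-Real.pi) Real.pi, ‖g (circleMap c ρ θ)‖ₑ := by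
  have hsub : closedBall c |ρ| ⊆ ball c r := by
    rw [abs_of_pos hρ]; exact closedBall_subset_ball hρr
  have h1 : Real.circleAverage g c ρ = g c := by
    refine circleAverage_of_differentiable_on_off_countable (s := ∅) Set.countable_empty
      (hg.continuousOn.mono hsub) fun z hz => ?_
    exact hg.differentiableAt (isOpen_ball.mem_nhds (hsub (ball_subset_closedBall hz.1)))
  have hper : Function.Periodic (fun θ => g (circleMap c ρ θ)) (2 * Real.pi) :=
    (periodic_circleMap c ρ).comp g
  -- The circle average runs over `[0, 2π]`; polar coordinates use `(-π, π)`.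
  have h2 := hper.intervalIntegral_add_eq 0 (-Real.pi)
  rw [zero_add, show -Real.pi + 2 * Real.pi = Real.pi by ring] at h2
  rw [Real.circleAverage_def, h2] at h1
  have h3 : ∫ θ in (-Real.pi)..Real.pi, g (circleMap c ρ θ) = (2 * Real.pi : ℝ) • g c := by
    rw [← h1, smul_smul, mul_inv_cancel₀ (by positivity), one_smul]
  rw [intervalIntegral.integral_of_le (by linarith [Real.pi_pos]),
    integral_Ioc_eq_integral_Ioo] at h3
  have h4 := enorm_integral_le_lintegral_enorm
    (μ := volume.restrict (Set.Ioo (-Real.pi) Real.pi)) fun θ => g (circleMap c ρ θ)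
  rw [h3, enorm_smul, Real.enorm_of_nonneg (by positivity), mul_comm] at h4
  exact h4

theorem lintegral_eq_polar {F : ℂ → ℝ≥0∞} (hF : Measurable F) (c : ℂ) :
    ∫⁻ z, F z = ∫⁻ ρ in Set.Ioi (0 : ℝ), ENNReal.ofReal ρ *
      ∫⁻ θ in Set.Ioo (-Real.pi) Real.pi, F (circleMap c ρ θ) := by
  have hmap : ∀ p : ℝ × ℝ, c + Complex.polarCoord.symm p = circleMap c p.1 p.2 := by
    intro p
    rw [Complex.polarCoord_symm_apply, circleMap, Complex.exp_mul_I, Complex.ofReal_cos,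
      Complex.ofReal_sin]
  have hm : Measurable fun p : ℝ × ℝ => circleMap c p.1 p.2 := by
    unfold circleMap; fun_prop
  rw [← lintegral_add_left_eq_self F c, ← Complex.lintegral_comp_polarCoord_symm]
  simp only [hmap, smul_eq_mul]
  rw [polarCoord_target, Measure.volume_eq_prod, ← Measure.prod_restrict, lintegral_prod]
  · refine lintegral_congr fun ρ => ?_
    simp only
    rw [lintegral_const_mul]
    exact hF.comp (hm.comp measurable_prodMk_left)
  · exact ((ENNReal.measurable_ofReal.comp measurable_fst).mul (hF.comp hm)).aemeasurable

/-- The sub-mean value property of `‖g‖` over disks. -/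
theorem enorm_mul_volume_ball_le_lintegral {g : ℂ → ℂ} {c : ℂ} {r : ℝ}
    (hg : DifferentiableOn ℂ g (ball c r)) :
    ‖g c‖ₑ * volume (ball c r) ≤ ∫⁻ z in ball c r, ‖g z‖ₑ := by
  classical
  have hmeas : Measurable ((ball c r).indicator fun z => ‖g z‖ₑ) := by
    have h : Measurable ((ball c r).piecewise g 0) :=
      hg.continuousOn.measurable_piecewise continuousOn_const measurableSet_ball
    convert h.enorm using 1
    funext z
    by_cases hz : z ∈ ball c r <;> simp [hz]
  -- Both sides become polar integrals centred at `c`, to be compared one circle at a time.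
  rw [← lintegral_indicator measurableSet_ball, ← setLIntegral_const,
    ← lintegral_indicator measurableSet_ball, lintegral_eq_polar hmeas c,
    lintegral_eq_polar (measurable_const.indicator measurableSet_ball) c]
  refine setLIntegral_mono' measurableSet_Ioi fun ρ hρ => ?_
  have hρ0 : 0 < ρ := hρ
  gcongr ENNReal.ofReal ρ * ?_
  by_cases hr : ρ < r
  · have hmem : ∀ θ, circleMap c ρ θ ∈ ball c r := fun θ => by
      simp [circleMap, abs_of_pos hρ0, hr]
    simp only [Set.indicator_of_mem (hmem _)]
    rw [setLIntegral_const, Real.volume_Ioo,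
      show Real.pi - -Real.pi = 2 * Real.pi by ring]
    exact enorm_mul_two_pi_le_lintegral_circleMap hg hρ0 hr
  · have hmem : ∀ θ, circleMap c ρ θ ∉ ball c r := fun θ => by
      simpa [circleMap, abs_of_pos hρ0] using hr
    simp only [Set.indicator_of_notMem (hmem _)]
    simp

/-! ### The Szegő kernel -/

namespace HardySpace

theorem memlp_geometric {w : ℂ} (hw : ‖w‖ < 1) :
    Memℓp (fun n : ℕ => (starRingEnd ℂ w) ^ n) 2 := by
  rw [memℓp_gen_iff (by simp)]
  simp only [norm_pow, RCLike.norm_conj, ENNReal.toReal_ofNat, Real.rpow_two, ← pow_mul']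
  simp only [pow_mul]
  exact summable_geometric_of_lt_one (by positivity) (by nlinarith [norm_nonneg w])

/-- The Szegő kernel `k_w(z) = 1 / (1 - w̄ z)`. -/
noncomputable def szego (w : ℂ) (hw : ‖w‖ < 1) : HardySpace :=
  coeffIso.symm ⟨_, memlp_geometric hw⟩

theorem coeff_szego {w : ℂ} (hw : ‖w‖ < 1) (n : ℕ) :
    coeff (szego w hw).toFun n = (starRingEnd ℂ w) ^ n := by
  have h : coeffIso (szego w hw) = ⟨_, memlp_geometric hw⟩ := coeffIso.apply_symm_apply _
  exact congrArg (fun a : lp (fun _ : ℕ => ℂ) 2 => a n) h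

/-- Pairing with the coefficients `w̄ⁿ` sums the Taylor series of `f` at `w`. -/
theorem inner_szego {w : ℂ} (hw : ‖w‖ < 1) (f : HardySpace) :
    inner ℂ (szego w hw) f = f.toFun w := by
  have h : HasSum (fun n => inner ℂ (coeff (szego w hw).toFun n) (coeff f.toFun n))
      (inner ℂ (szego w hw) f) := lp.hasSum_inner (coeffMap (szego w hw)) (coeffMap f)
  refine h.unique ?_
  convert hasSum_coeff f.differentiableOn (z := w) (by simpa using hw) using 2 with n
  simp [coeff_szego, mul_comm]

theorem szego_apply {w : ℂ} (hw : ‖w‖ < 1) {z : ℂ} (hz : ‖z‖ < 1) :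
    (szego w hw).toFun z = (1 - starRingEnd ℂ w * z)⁻¹ := by
  have h := hasSum_coeff (szego w hw).differentiableOn (z := z) (by simpa using hz)
  simp only [coeff_szego, ← mul_pow] at h
  refine h.unique (hasSum_geometric_of_norm_lt_one ?_)
  rw [norm_mul, RCLike.norm_conj]
  nlinarith [norm_nonneg w, norm_nonneg z]

theorem norm_szego_sq {w : ℂ} (hw : ‖w‖ < 1) : ‖szego w hw‖ ^ 2 = (1 - ‖w‖ ^ 2)⁻¹ := by
  have h := inner_szego hw (szego w hw)
  rw [inner_self_eq_norm_sq_to_K, szego_apply hw hw, Complex.conj_mul'] at h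
  apply Complex.ofReal_injective
  push_cast
  exact h

theorem norm_apply_le (f : HardySpace) {w : ℂ} (hw : ‖w‖ < 1) :
    ‖f.toFun w‖ ≤ ‖szego w hw‖ * ‖f‖ := by
  rw [← inner_szego hw]
  exact norm_inner_le_norm _ _

theorem differentiableAt (f : HardySpace) {z : ℂ} (hz : z ∈ ball (0 : ℂ) 1) :
    DifferentiableAt ℂ f.toFun z :=
  f.differentiableOn.differentiableAt (isOpen_ball.mem_nhds hz)

theorem deriv_add {f g : HardySpace} {z : ℂ} (hz : z ∈ ball (0 : ℂ) 1) :
    deriv (f + g).toFun z = deriv f.toFun z + deriv g.toFun z := by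
  rw [toFun_add]
  exact _root_.deriv_add (f.differentiableAt hz) (g.differentiableAt hz)

theorem deriv_smul (a : ℂ) (f : HardySpace) (z : ℂ) :
    deriv (a • f).toFun z = a * deriv f.toFun z := by
  rw [toFun_smul]
  exact deriv_const_smul_field a f.toFun

/-- Cauchy's estimate on a small circle about `z`, where point evaluations are uniformly bounded by
the Szegő kernel norms. -/
theorem exists_norm_deriv_le {z : ℂ} (hz : z ∈ ball (0 : ℂ) 1) :
    ∃ C, ∀ f : HardySpace, ‖deriv f.toFun z‖ ≤ C * ‖f‖ := by
  have hz1 : ‖z‖ < 1 := by simpa using hz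
  set R := (1 - ‖z‖) / 2 with hR
  have hR0 : 0 < R := by rw [hR]; linarith
  set s := ‖z‖ + R with hs
  have hs1 : s < 1 := by rw [hs, hR]; linarith
  have hs0 : 0 ≤ s := by positivity
  have hsq : 0 < 1 - s ^ 2 := by nlinarith
  refine ⟨Real.sqrt (1 - s ^ 2)⁻¹ / R, fun f => ?_⟩
  rw [div_mul_eq_mul_div]
  have hcl : closedBall z R ⊆ ball 0 1 := by
    intro u hu
    have h1 : ‖u - z‖ ≤ R := by simpa [dist_eq_norm] using hu
    have h2 := norm_le_norm_add_norm_sub' u z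
    simp only [mem_ball, dist_zero_right]
    linarith
  refine Complex.norm_deriv_le_of_forall_mem_sphere_norm_le hR0 ?_ fun u hu => ?_
  · exact (f.differentiableOn.mono hcl).diffContOnCl_ball subset_rfl
  · have h1 : ‖u - z‖ = R := by simpa [dist_eq_norm] using hu
    have h2 := norm_le_norm_add_norm_sub' u z
    have h3 : ‖u‖ ≤ s := by linarith
    have hu1 : ‖u‖ < 1 := by linarith
    refine (f.norm_apply_le hu1).trans ?_
    gcongr
    apply Real.le_sqrt_of_sq_le
    rw [norm_szego_sq]
    gcongr

theorem tendsto_deriv {ι : Type*} {l : Filter ι} {f : ι → HardySpace} {g : HardySpace}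
    (h : Tendsto f l (𝓝 g)) {z : ℂ} (hz : z ∈ ball (0 : ℂ) 1) :
    Tendsto (fun i => deriv (f i).toFun z) l (𝓝 (deriv g.toFun z)) := by
  obtain ⟨C, hC⟩ := exists_norm_deriv_le hz
  let D : HardySpace →ₗ[ℂ] ℂ :=
    { toFun := fun f => deriv f.toFun z
      map_add' := fun f g => deriv_add hz
      map_smul' := fun a f => deriv_smul a f z }
  exact ((D.mkContinuous C hC).continuous.tendsto g).comp h

end HardySpace

/-! ### Kernels of de Branges–Rovnyak spaces -/

section kernel

variable {b : ℂ → ℂ} (hb : InUnitBall b) {w : ℂ} (hw : ‖w‖ < 1)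

/-- Both sides pair with `f` to `b(w) f(w)`, by the reproducing property. -/
theorem adjoint_mulOp_szego :
    ContinuousLinearMap.adjoint (mulOp b hb) (HardySpace.szego w hw) =
      starRingEnd ℂ (b w) • HardySpace.szego w hw := by
  refine ext_inner_right ℂ fun f => ?_
  rw [ContinuousLinearMap.adjoint_inner_left, HardySpace.inner_szego, inner_smul_left,
    HardySpace.inner_szego, mulOp_apply, RCLike.conj_conj]

theorem defect_szego_apply {z : ℂ} (hz : ‖z‖ < 1) :
    (defect b hb (HardySpace.szego w hw)).toFun z =
      (1 - starRingEnd ℂ (b w) * b z) * (1 - starRingEnd ℂ w * z)⁻¹ := by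
  have h : defect b hb (HardySpace.szego w hw) = HardySpace.szego w hw +
      (-starRingEnd ℂ (b w)) • mulOp b hb (HardySpace.szego w hw) := by
    rw [defect, sub_apply, mul_apply_eq_comp,
      adjoint_mulOp_szego, map_smul, neg_smul, sub_eq_add_neg]
    rfl
  rw [h, HardySpace.toFun_add, HardySpace.toFun_smul]
  simp only [Pi.add_apply, Pi.smul_apply, smul_eq_mul, mulOp_apply, HardySpace.szego_apply hw hz]
  ring

theorem sqrt_defect_sqrt_defect (f : HardySpace) :
    CFC.sqrt (defect b hb) (CFC.sqrt (defect b hb) f) = defect b hb f := by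
  rw [← mul_apply_eq_comp, CFC.sqrt_mul_sqrt_self _ (defect_nonneg b hb)]

/-- The square root is self-adjoint, so this is `⟪k_w, (I - T_b T_b^*) k_w⟫`, the value of the
`H(b)` kernel `K_w` at `w`. -/
theorem norm_sqrt_defect_szego_sq :
    ‖CFC.sqrt (defect b hb) (HardySpace.szego w hw)‖ ^ 2 =
      (1 - ‖b w‖ ^ 2) * (1 - ‖w‖ ^ 2)⁻¹ := by
  have hsa : ContinuousLinearMap.adjoint (CFC.sqrt (defect b hb)) = CFC.sqrt (defect b hb) :=
    (CFC.sqrt_nonneg (defect b hb)).isSelfAdjoint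
  have h : inner ℂ (CFC.sqrt (defect b hb) (HardySpace.szego w hw))
      (CFC.sqrt (defect b hb) (HardySpace.szego w hw)) =
      (1 - starRingEnd ℂ (b w) * b w) * (1 - starRingEnd ℂ w * w)⁻¹ := by
    rw [← defect_szego_apply hb hw hw, ← HardySpace.inner_szego hw, ← sqrt_defect_sqrt_defect]
    conv_rhs => rw [← ContinuousLinearMap.adjoint_inner_left, hsa]
  rw [inner_self_eq_norm_sq_to_K, Complex.conj_mul', Complex.conj_mul'] at h
  apply Complex.ofReal_injective
  push_cast
  exact h

end kernel

/-! ### Boundedness of the embedding -/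

section embedding

variable (μ : Measure (sphere (0 : ℂ) 1))

theorem measurable_poissonIntegral [SFinite μ] : Measurable (poissonIntegral μ) := by
  refine Measurable.lintegral_prod_right' (f := fun p : ℂ × sphere (0 : ℂ) 1 =>
    ENNReal.ofReal ((1 - ‖p.1‖ ^ 2) / ‖p.1 - p.2‖ ^ 2)) ?_
  fun_prop

/-- The measure `P_μ dA` on the unit disk. -/
noncomputable def poissonMeasure : Measure ℂ :=
  (volume.restrict (ball 0 1)).withDensity (poissonIntegral μ)

variable {μ}

theorem ae_poissonMeasure {p : ℂ → Prop} (h : ∀ z ∈ ball (0 : ℂ) 1, p z) :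
    ∀ᵐ z ∂poissonMeasure μ, p z :=
  (withDensity_absolutelyContinuous _ _).ae_le (ae_restrict_of_forall_mem measurableSet_ball h)

/-- Makes Minkowski's inequality and Fatou's lemma in `L²` available. -/
theorem dirichletIntegral_eq_eLpNorm [SFinite μ] (f : ℂ → ℂ) :
    dirichletIntegral μ f = eLpNorm (deriv f) 2 (poissonMeasure μ) ^ 2 := by
  rw [dirichletIntegral, eLpNorm_eq_lintegral_rpow_enorm_toReal (by simp) (by simp),
    ← ENNReal.rpow_two, ← ENNReal.rpow_mul, poissonMeasure,
    lintegral_withDensity_eq_lintegral_mul _ (measurable_poissonIntegral μ)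
      ((measurable_deriv f).enorm.pow_const _)]
  simp [mul_comm]

/-- A Baire category argument: an everywhere finite, lower semicontinuous seminorm on a Banach space
is continuous, hence bounded. -/
theorem exists_dirichletIntegral_le [SFinite μ] (A : HardySpace →L[ℂ] HardySpace)
    (hA : ∀ f, (A f).toFun ∈ dirichletSpace μ) :
    ∃ C : ℝ, ∀ f, dirichletIntegral μ (A f).toFun ≤ ENNReal.ofReal (C * ‖f‖ ^ 2) := by
  set N : HardySpace → ℝ≥0∞ := fun f => eLpNorm (deriv (A f).toFun) 2 (poissonMeasure μ) with hN
  have hfin : ∀ f, N f ≠ ∞ := fun f h => by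
    have := (hA f).2
    rw [dirichletIntegral_eq_eLpNorm] at this
    simp only [hN] at h
    simp [h] at this
  have hadd : ∀ f g, N (f + g) ≤ N f + N g := fun f g => by
    have : N (f + g) =
        eLpNorm (deriv (A f).toFun + deriv (A g).toFun) 2 (poissonMeasure μ) :=
      eLpNorm_congr_ae (ae_poissonMeasure fun z hz => by
        rw [map_add]; exact HardySpace.deriv_add hz)
    rw [this]
    exact eLpNorm_add_le (measurable_deriv _).aestronglyMeasurable
      (measurable_deriv _).aestronglyMeasurable (by norm_num)
  have hsmul : ∀ (a : ℂ) f, N (a • f) = ‖a‖ₑ * N f := fun a f => by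
    have : deriv (A (a • f)).toFun = a • deriv (A f).toFun := by
      funext z; rw [map_smul]; exact HardySpace.deriv_smul a _ z
    simp only [hN, this]
    exact eLpNorm_const_smul _ _ _ _
  let p : Seminorm ℂ HardySpace := Seminorm.of (fun f => (N f).toReal)
    (fun f g => by
      rw [← ENNReal.toReal_add (hfin f) (hfin g)]
      exact ENNReal.toReal_mono (ENNReal.add_ne_top.2 ⟨hfin f, hfin g⟩) (hadd f g))
    (fun a f => by simp [hsmul])
  have hlsc : LowerSemicontinuous p := by
    rw [lowerSemicontinuous_iff_isClosed_preimage]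
    intro y
    -- Sublevel sets are closed by Fatou, since `H²` convergence forces pointwise convergence of
    -- derivatives.
    rw [← isSeqClosed_iff_isClosed]
    intro u f hu hf
    have hy : 0 ≤ y := ENNReal.toReal_nonneg.trans (hu 0)
    have hle : N f ≤ ENNReal.ofReal y := by
      refine (Lp.eLpNorm_lim_le_liminf_eLpNorm
        (fun n => (measurable_deriv (A (u n)).toFun).aestronglyMeasurable) _
        (ae_poissonMeasure fun z hz =>
          HardySpace.tendsto_deriv ((A.continuous.tendsto f).comp hf) hz)).trans ?_
      refine liminf_le_of_le (by isBoundedDefault) fun c hc => ?_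
      obtain ⟨n, hn⟩ := hc.exists
      exact hn.trans ((ENNReal.le_ofReal_iff_toReal_le (hfin _) hy).2 (hu n))
    exact (ENNReal.le_ofReal_iff_toReal_le (hfin _) hy).1 hle
  obtain ⟨C, hC0, hC⟩ := Seminorm.bound_of_continuous_normedSpace p
    (p.continuous_of_lowerSemicontinuous hlsc)
  refine ⟨C ^ 2, fun f => ?_⟩
  rw [dirichletIntegral_eq_eLpNorm, ← mul_pow, ENNReal.ofReal_pow (by positivity)]
  gcongr
  exact (ENNReal.le_ofReal_iff_toReal_le (hfin _) (by positivity)).2 (hC f)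

end embedding

/-! ### The potential -/

section potential

variable {μ : Measure (sphere (0 : ℂ) 1)}

theorem measurable_potentialKernel (z : ℂ) :
    Measurable fun ζ : sphere (0 : ℂ) 1 => (‖(ζ : ℂ) - z‖ₑ ^ 2)⁻¹ := by
  fun_prop

/-- Fatou's lemma along a sequence tending to `ζ`. -/
theorem potential_le_of_frequently {s : Set ℂ} {ζ : ℂ} {C : ℝ≥0∞}
    (h : ∃ᶠ z in 𝓝[s] ζ, potential μ z ≤ C) : potential μ ζ ≤ C := by
  obtain ⟨u, hu, huC⟩ := exists_seq_forall_of_frequently h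
  have hu' : Tendsto u atTop (𝓝 ζ) := hu.mono_right nhdsWithin_le_nhds
  have hlim : ∀ x : sphere (0 : ℂ) 1,
      liminf (fun n => (‖(x : ℂ) - u n‖ₑ ^ 2)⁻¹) atTop = (‖(x : ℂ) - ζ‖ₑ ^ 2)⁻¹ := by
    intro x
    refine Tendsto.liminf_eq ?_
    -- Continuity in `[0, ∞]` covers `x = ζ`, where the limit is `∞`.
    have hc : Continuous fun z : ℂ => (‖(x : ℂ) - z‖ₑ ^ 2)⁻¹ :=
      continuous_inv.comp ((ENNReal.continuous_pow 2).comp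
        (continuous_enorm.comp (continuous_const.sub continuous_id)))
    exact (hc.tendsto ζ).comp hu'
  calc potential μ ζ = ∫⁻ x, liminf (fun n => (‖(x : ℂ) - u n‖ₑ ^ 2)⁻¹) atTop ∂μ := by
        simp only [hlim]; rfl
    _ ≤ liminf (fun n => potential μ (u n)) atTop :=
        lintegral_liminf_le fun n => measurable_potentialKernel (u n)
    _ ≤ C := by
        refine liminf_le_of_le (by isBoundedDefault) fun c hc => ?_
        obtain ⟨n, hn⟩ := hc.exists
        exact hn.trans (huC n)

/-- Markov's inequality: the integrand of the potential at `ζ` is at least `d⁻²` on `A`. -/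
theorem measure_le_potential {A : Set (sphere (0 : ℂ) 1)} {ζ : sphere (0 : ℂ) 1} {d : ℝ≥0∞}
    (hd : d ≠ 0) (hd' : d ≠ ∞) (hA : ∀ x ∈ A, ‖(x : ℂ) - ζ‖ₑ ≤ d) :
    μ A ≤ d ^ 2 * potential μ ζ := by
  have h := mul_meas_ge_le_lintegral (μ := μ) (measurable_potentialKernel (ζ : ℂ)) ((d ^ 2)⁻¹)
  have hsub : A ⊆ {x | (d ^ 2)⁻¹ ≤ (‖(x : ℂ) - ζ‖ₑ ^ 2)⁻¹} := fun x hx =>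
    ENNReal.inv_le_inv.2 (pow_le_pow_left' (hA x hx) 2)
  have h2 : (d ^ 2)⁻¹ * μ A ≤ potential μ ζ := le_trans (by gcongr) h
  rwa [mul_comm, ← div_eq_mul_inv, ENNReal.div_le_iff' (by simpa using hd)
    (by simpa using hd')] at h2

/-- The points of the circle whose argument lies in `[k / N, (k + 1) / N)`. -/
def argArc (N : ℕ) (k : ℤ) : Set (sphere (0 : ℂ) 1) :=
  {ζ | ⌊N * Complex.arg ζ⌋ = k}

theorem norm_sub_le_of_mem_argArc {N : ℕ} (hN : 0 < N) {k : ℤ} {x y : sphere (0 : ℂ) 1}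
    (hx : x ∈ argArc N k) (hy : y ∈ argArc N k) : ‖(x : ℂ) - y‖ ≤ 1 / N := by
  have hexp : ∀ z : sphere (0 : ℂ) 1, (z : ℂ) = circleMap 0 1 (Complex.arg z) := fun z => by
    have h := Complex.norm_mul_exp_arg_mul_I (z : ℂ)
    rw [show ‖(z : ℂ)‖ = 1 by simp] at h
    simpa [circleMap] using h.symm
  have h1 : |N * Complex.arg x - N * Complex.arg y| < 1 :=
    Int.abs_sub_lt_one_of_floor_eq_floor (hx.trans hy.symm)
  have h2 : ‖(x : ℂ) - y‖ ≤ |Complex.arg x - Complex.arg y| := by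
    have h := (lipschitzWith_circleMap 0 1).dist_le_mul (Complex.arg x) (Complex.arg y)
    rw [← hexp, ← hexp, dist_eq_norm, Real.dist_eq] at h
    simpa using h
  have hN' : (0 : ℝ) < N := by exact_mod_cast hN
  rw [← mul_sub, abs_mul, abs_of_pos hN'] at h1
  rw [le_div_iff₀ hN']
  nlinarith

theorem measure_setOf_potential_le (n : ℕ) :
    μ {ζ : sphere (0 : ℂ) 1 | potential μ (ζ : ℂ) ≤ n} = 0 := by
  set E := {ζ : sphere (0 : ℂ) 1 | potential μ (ζ : ℂ) ≤ n} with hE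
  have hbound : ∀ N : ℕ, 0 < N → μ E ≤ ENNReal.ofReal (9 * n / N) := by
    intro N hN
    have hN' : (0 : ℝ) < N := by exact_mod_cast hN
    -- `|arg| ≤ π < 4` leaves `8N + 1 ≤ 9N` indices, whence the factor `9`.
    have hcover : E ⊆ ⋃ k ∈ Finset.Icc (-(4 * N) : ℤ) (4 * N), argArc N k ∩ E := by
      intro ζ hζ
      simp only [Set.mem_iUnion, exists_prop]
      refine ⟨⌊N * Complex.arg ζ⌋, ?_, rfl, hζ⟩
      have h1 := Complex.neg_pi_lt_arg (ζ : ℂ)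
      have h2 := Complex.arg_le_pi (ζ : ℂ)
      have h3 := Real.pi_lt_four
      rw [Finset.mem_Icc, Int.le_floor]
      refine ⟨by push_cast; nlinarith, ?_⟩
      have h4 := Int.floor_le (N * Complex.arg (ζ : ℂ))
      have : ((⌊N * Complex.arg (ζ : ℂ)⌋ : ℤ) : ℝ) ≤ ((4 * N : ℤ) : ℝ) := by
        push_cast; nlinarith
      exact_mod_cast this
    have harc : ∀ k, μ (argArc N k ∩ E) ≤ ENNReal.ofReal (n / N ^ 2) := by
      intro k
      rcases (argArc N k ∩ E).eq_empty_or_nonempty with h0 | ⟨ζ, hζ, hζE⟩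
      · simp [h0]
      · refine (measure_mono Set.inter_subset_left).trans ((measure_le_potential
          (ζ := ζ)
          (d := ENNReal.ofReal (1 / N)) (by simpa using hN.ne') (by simp) fun x hx => ?_).trans ?_)
        · rw [← ofReal_norm]
          exact ENNReal.ofReal_le_ofReal (norm_sub_le_of_mem_argArc hN hx hζ)
        · refine (mul_le_mul_right hζE _).trans (le_of_eq ?_)
          rw [← ENNReal.ofReal_pow (by positivity), ← ENNReal.ofReal_natCast,
            ← ENNReal.ofReal_mul (by positivity)]
          congr 1
          ring
    calc μ E ≤ ∑ k ∈ Finset.Icc (-(4 * N) : ℤ) (4 * N), μ (argArc N k ∩ E) :=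
          (measure_mono hcover).trans (measure_biUnion_finset_le _ _)
      _ ≤ ∑ _k ∈ Finset.Icc (-(4 * N) : ℤ) (4 * N), ENNReal.ofReal (n / N ^ 2) :=
          Finset.sum_le_sum fun k _ => harc k
      _ = ENNReal.ofReal ((8 * N + 1 : ℕ) * (n / N ^ 2)) := by
          rw [Finset.sum_const, Int.card_Icc, ENNReal.ofReal_mul (by positivity),
            ENNReal.ofReal_natCast, nsmul_eq_mul]
          congr 2
          lia
      _ ≤ ENNReal.ofReal (9 * n / N) := by
          refine ENNReal.ofReal_le_ofReal ?_
          have h1 : (1 : ℝ) ≤ N := by exact_mod_cast hN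
          push_cast
          rw [mul_div_assoc', div_le_div_iff₀ (by positivity) (by positivity)]
          have : 0 ≤ (n : ℝ) * N * (N * (N - 1)) := by
            have := sub_nonneg.2 h1; positivity
          nlinarith [this]
  have hlim : Tendsto (fun N : ℕ => ENNReal.ofReal (9 * n / N)) atTop (𝓝 0) := by
    rw [← ENNReal.ofReal_zero]
    exact ENNReal.tendsto_ofReal (tendsto_const_div_atTop_nhds_zero_nat _)
  exact le_antisymm (ge_of_tendsto hlim
    (eventually_atTop.2 ⟨1, fun N hN => hbound N hN⟩)) zero_le

theorem measure_eq_zero_of_potential_lt_top {E : Set (sphere (0 : ℂ) 1)}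
    (hE : ∀ ζ ∈ E, potential μ (ζ : ℂ) < ∞) : μ E = 0 := by
  refine measure_mono_null (t := ⋃ n : ℕ, {ζ : sphere (0 : ℂ) 1 | potential μ (ζ : ℂ) ≤ n})
    (fun ζ hζ => ?_) (measure_iUnion_null fun n => measure_setOf_potential_le n)
  obtain ⟨n, hn⟩ := ENNReal.exists_nat_gt (hE ζ hζ).ne
  exact Set.mem_iUnion.2 ⟨n, hn.le⟩

end potential

/-! ### Potentials at points where `|b|` is bounded away from `1` -/

section estimate

variable {b : ℂ → ℂ} (hb : InUnitBall b) {w : ℂ} (hw : ‖w‖ < 1)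

theorem le_norm_defect_szego_self {ε : ℝ} (hε : ε ≤ 1 - ‖b w‖ ^ 2) (hε0 : 0 < ε) :
    ε / (2 * (1 - ‖w‖)) ≤ ‖(defect b hb (HardySpace.szego w hw)).toFun w‖ := by
  have h : (defect b hb (HardySpace.szego w hw)).toFun w =
      (((1 - ‖b w‖ ^ 2) * (1 - ‖w‖ ^ 2)⁻¹ : ℝ) : ℂ) := by
    rw [defect_szego_apply hb hw hw, Complex.conj_mul', Complex.conj_mul']
    push_cast
    rfl
  have h0 := norm_nonneg w
  have h1 : 0 < 1 - ‖w‖ ^ 2 := by nlinarith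
  rw [h, Complex.norm_real, ← div_eq_mul_inv]
  refine le_trans ?_ (le_abs_self _)
  have h2 : 1 - ‖w‖ ^ 2 ≤ 2 * (1 - ‖w‖) := by nlinarith
  exact div_le_div₀ (hε0.le.trans hε) hε h1 h2

/-- The kernel's numerator is at most `2`, and its denominator is at least `1 - (1 - t)|w|² ≥ t`. -/
theorem norm_defect_szego_le {t : ℝ} (ht : 0 < t) (ht1 : t ≤ 1) :
    ‖(defect b hb (HardySpace.szego w hw)).toFun ((1 - t : ℝ) * w)‖ ≤ 2 / t := by
  have h0 := norm_nonneg w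
  have hn : ‖((1 - t : ℝ) : ℂ) * w‖ = (1 - t) * ‖w‖ := by
    rw [norm_mul, Complex.norm_real, Real.norm_of_nonneg (by linarith)]
  have hz : ‖((1 - t : ℝ) : ℂ) * w‖ < 1 := by rw [hn]; nlinarith
  rw [defect_szego_apply hb hw hz, norm_mul, norm_inv, ← div_eq_mul_inv]
  refine div_le_div₀ two_pos.le ?_ ht ?_
  · refine (norm_sub_le _ _).trans ?_
    rw [norm_one, norm_mul, RCLike.norm_conj]
    have h1 := hb.norm_le_one w (by simpa using hw)
    have h2 := hb.norm_le_one _ (show ((1 - t : ℝ) : ℂ) * w ∈ ball 0 1 by simpa using hz)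
    have := mul_le_one₀ h1 (norm_nonneg _) h2
    linarith
  · have h1 := norm_sub_norm_le 1 (starRingEnd ℂ w * (((1 - t : ℝ) : ℂ) * w))
    rw [norm_one, norm_mul, RCLike.norm_conj, hn] at h1
    nlinarith [mul_nonneg (sub_nonneg.2 ht1) (mul_nonneg (sub_nonneg.2 hw.le)
      (by linarith : 0 ≤ 1 + ‖w‖))]

/-- The mean value inequality on the segment from `(1 - t)w` to `w`, whose ends carry very different
kernel values. -/
theorem exists_le_norm_deriv_defect_szego {ε : ℝ} (hε : ε ≤ 1 - ‖b w‖ ^ 2) (hε0 : 0 < ε)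
    (hδ : 8 / ε * (1 - ‖w‖) ≤ 1) :
    ∃ z, ‖z‖ ≤ ‖w‖ ∧ ‖z - w‖ ≤ 8 / ε * (1 - ‖w‖) ∧
      ε ^ 2 / 64 / (1 - ‖w‖) ^ 2 ≤ ‖deriv (defect b hb (HardySpace.szego w hw)).toFun z‖ := by
  set δ := 1 - ‖w‖ with hδdef
  have hδ0 : 0 < δ := by linarith
  set F := defect b hb (HardySpace.szego w hw) with hF
  -- With this `t` the inner value is at most `2/t = ε/(4δ)`, half the lower bound `ε/(2δ)` at `w`.
  -- The negated derivative bound would allow a change of only `ε/(8δ)`.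
  set t := 8 / ε * δ with ht
  have ht0 : 0 < t := by positivity
  by_contra! hcon
  have hconv : Convex ℝ (closedBall (0 : ℂ) ‖w‖ ∩ closedBall w t) :=
    (convex_closedBall _ _).inter (convex_closedBall _ _)
  have hmem : ∀ z ∈ closedBall (0 : ℂ) ‖w‖ ∩ closedBall w t, ‖z‖ ≤ ‖w‖ ∧ ‖z - w‖ ≤ t := by
    intro z hz
    simpa [dist_eq_norm] using hz
  have hdiff : ‖w - (1 - t : ℝ) * w‖ = t * ‖w‖ := by
    rw [show w - ((1 - t : ℝ) : ℂ) * w = (t : ℂ) * w by push_cast; ring, norm_mul,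
      Complex.norm_real, Real.norm_of_nonneg ht0.le]
  have hdt : t * ‖w‖ ≤ t := mul_le_of_le_one_right ht0.le hw.le
  have h1 := hconv.norm_image_sub_le_of_norm_deriv_le (f := F.toFun)
    (C := ε ^ 2 / 64 / δ ^ 2) (x := ((1 - t : ℝ) : ℂ) * w) (y := w)
    (fun z hz => F.differentiableAt (by simpa using (hmem z hz).1.trans_lt hw))
    (fun z hz => (hcon z (hmem z hz).1 (hmem z hz).2).le)
    (by
      constructor
      · simp only [mem_closedBall, dist_zero_right]
        rw [norm_mul, Complex.norm_real, Real.norm_of_nonneg (by linarith)]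
        exact mul_le_of_le_one_left (norm_nonneg _) (by linarith)
      · rw [mem_closedBall', dist_eq_norm, hdiff]
        exact hdt)
    (by simp [ht0.le])
  rw [hdiff] at h1
  have h2 := le_norm_defect_szego_self hb hw hε hε0
  have h3 := norm_defect_szego_le hb hw ht0 hδ
  have h4 := norm_sub_norm_le (F.toFun w) (F.toFun ((1 - t : ℝ) * w))
  have h5 : ε ^ 2 / 64 / δ ^ 2 * (t * ‖w‖) ≤ ε ^ 2 / 64 / δ ^ 2 * t := by gcongr
  have e1 : ε ^ 2 / 64 / δ ^ 2 * t = (ε / δ) / 8 := by rw [ht]; field_simp; ring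
  have e2 : 2 / t = (ε / δ) / 4 := by rw [ht]; field_simp; ring
  have e3 : ε / (2 * δ) = (ε / δ) / 2 := by field_simp
  have h6 : 0 < ε / δ := by positivity
  rw [e1] at h5
  rw [← hF, e2] at h3
  rw [← hF, e3] at h2
  linarith

end estimate

/-! ### Comparing the Dirichlet integral with the potential -/

/-- Compare integrands, with `δ = 1 - ‖w‖`: `1 - |u|² ≥ δ/2`, and `|u - x| ≤ δ/2 + Kδ + |x - w| ≤ (K
+ 2)|x - w|` because `δ ≤ |x - w|` on the circle. -/
theorem mul_potential_le_poissonIntegral (μ : Measure (sphere (0 : ℂ) 1)) {w z : ℂ} {K : ℝ}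
    (hK : 0 < K) (hw : ‖w‖ < 1) (hz : ‖z‖ ≤ ‖w‖) (hzw : ‖z - w‖ ≤ K * (1 - ‖w‖)) {u : ℂ}
    (hu : u ∈ ball z ((1 - ‖w‖) / 2)) :
    ENNReal.ofReal ((1 - ‖w‖) / (2 * (K + 2) ^ 2)) * potential μ w ≤ poissonIntegral μ u := by
  set δ := 1 - ‖w‖ with hδ
  have hδ0 : 0 < δ := by linarith
  rw [potential, poissonIntegral, ← lintegral_const_mul _ (measurable_potentialKernel w)]
  refine lintegral_mono fun x => ?_
  have hx : ‖(x : ℂ)‖ = 1 := by simp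
  have huz : ‖u - z‖ < δ / 2 := by simpa [dist_eq_norm] using hu
  have hun : ‖u‖ ≤ 1 - δ / 2 := by
    have := norm_le_norm_add_norm_sub' u z
    linarith
  have hxw : δ ≤ ‖(x : ℂ) - w‖ := by
    have := norm_sub_norm_le (x : ℂ) w
    linarith
  have hux0 : 0 < ‖u - x‖ := by
    have := norm_sub_norm_le (x : ℂ) u
    rw [norm_sub_rev] at this
    linarith
  have hux : ‖u - x‖ ≤ (K + 2) * ‖(x : ℂ) - w‖ := by
    have h1 : ‖u - x‖ ≤ ‖u - z‖ + ‖z - w‖ + ‖(x : ℂ) - w‖ := by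
      have h2 := norm_sub_le_norm_sub_add_norm_sub u z (x : ℂ)
      have h3 := norm_sub_le_norm_sub_add_norm_sub z w (x : ℂ)
      rw [norm_sub_rev w] at h3
      linarith
    nlinarith
  have hxw0 : 0 < ‖(x : ℂ) - w‖ := hδ0.trans_le hxw
  have h0 := norm_nonneg u
  rw [← ofReal_norm, ← ENNReal.ofReal_pow (norm_nonneg _),
    ← ENNReal.ofReal_inv_of_pos (by positivity), ← ENNReal.ofReal_mul (by positivity)]
  refine ENNReal.ofReal_le_ofReal ?_
  rw [← div_eq_mul_inv, div_div]
  calc δ / (2 * (K + 2) ^ 2 * ‖(x : ℂ) - w‖ ^ 2)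
      = (δ / 2) / ((K + 2) * ‖(x : ℂ) - w‖) ^ 2 := by field_simp
    _ ≤ (1 - ‖u‖ ^ 2) / ‖u - x‖ ^ 2 := by
        refine div_le_div₀ ?_ ?_ (by positivity) (by gcongr) <;> nlinarith

theorem mul_potential_le_dirichletIntegral (μ : Measure (sphere (0 : ℂ) 1)) {f : ℂ → ℂ}
    (hf : DifferentiableOn ℂ f (ball 0 1)) {w z : ℂ} {K : ℝ} (hK : 0 < K) (hw : ‖w‖ < 1)
    (hz : ‖z‖ ≤ ‖w‖) (hzw : ‖z - w‖ ≤ K * (1 - ‖w‖)) :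
    ENNReal.ofReal ((1 - ‖w‖) ^ 3 / (8 * (K + 2) ^ 2) * ‖deriv f z‖ ^ 2) * potential μ w ≤
      dirichletIntegral μ f := by
  set δ := 1 - ‖w‖ with hδ
  have hδ0 : 0 < δ := by linarith
  have hsub : ball z (δ / 2) ⊆ ball 0 1 := by
    refine ball_subset_ball' ?_
    rw [dist_zero_right]
    linarith
  have hmean := enorm_mul_volume_ball_le_lintegral
    (((hf.deriv isOpen_ball).mono hsub).pow 2)
  simp only [Pi.pow_apply, enorm_pow, Complex.volume_ball] at hmean
  -- The area `π(δ/2)²` is only used through the bound `(δ/2)²`.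
  have hpi : (1 : ℝ≥0∞) ≤ NNReal.pi := by
    have h : (1 : ℝ) ≤ (NNReal.pi : ℝ) := by
      rw [NNReal.coe_real_pi]; linarith [Real.pi_gt_three]
    exact_mod_cast h
  calc ENNReal.ofReal (δ ^ 3 / (8 * (K + 2) ^ 2) * ‖deriv f z‖ ^ 2) * potential μ w
      = ‖deriv f z‖ₑ ^ 2 * (ENNReal.ofReal (δ / 2) ^ 2 * 1) *
          (ENNReal.ofReal (δ / (2 * (K + 2) ^ 2)) * potential μ w) := by
        rw [← ofReal_norm, ← ENNReal.ofReal_pow (norm_nonneg _),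
          ← ENNReal.ofReal_pow (by positivity), mul_one, ← mul_assoc,
          ← ENNReal.ofReal_mul (by positivity), ← ENNReal.ofReal_mul (by positivity)]
        congr 2
        field_simp
        ring
    _ ≤ (∫⁻ u in ball z (δ / 2), ‖deriv f u‖ₑ ^ 2) *
          (ENNReal.ofReal (δ / (2 * (K + 2) ^ 2)) * potential μ w) := by
        gcongr
        refine le_trans ?_ hmean
        gcongr
    _ = ∫⁻ u in ball z (δ / 2), ‖deriv f u‖ₑ ^ 2 *
          (ENNReal.ofReal (δ / (2 * (K + 2) ^ 2)) * potential μ w) := by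
        rw [lintegral_mul_const]
        exact (measurable_deriv f).enorm.pow_const 2
    _ ≤ ∫⁻ u in ball z (δ / 2), ‖deriv f u‖ₑ ^ 2 * poissonIntegral μ u := by
        refine setLIntegral_mono' measurableSet_ball fun u hu => ?_
        gcongr
        exact mul_potential_le_poissonIntegral μ hK hw hz hzw hu
    _ ≤ dirichletIntegral μ f := lintegral_mono_set hsub

/-! ### Uniform bounds on the potential and passage to the boundary -/

theorem exists_potential_le {μ : Measure (sphere (0 : ℂ) 1)} [SFinite μ] {b : ℂ → ℂ}
    (hb : InUnitBall b) (hsub : deBrangesRovnyak b hb ⊆ dirichletSpace μ) {ε : ℝ} (hε0 : 0 < ε) :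
    ∃ C : ℝ, ∀ w : ℂ, ‖w‖ < 1 → ε ≤ 1 - ‖b w‖ ^ 2 → 8 / ε * (1 - ‖w‖) ≤ 1 →
      potential μ w ≤ ENNReal.ofReal C := by
  obtain ⟨C, hC⟩ := exists_dirichletIntegral_le (CFC.sqrt (defect b hb))
    fun f => hsub ⟨f, rfl⟩
  -- The squared derivative bound times the comparison constant for `K = 8/ε`, with the powers of
  -- `δ` removed.
  set κ : ℝ := (ε ^ 2 / 64) ^ 2 / (8 * (8 / ε + 2) ^ 2) with hκ
  have hκ0 : 0 < κ := by positivity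
  refine ⟨|C| / κ, fun w hw hε hδ => ?_⟩
  obtain ⟨z, hz, hzw, hder⟩ := exists_le_norm_deriv_defect_szego hb hw hε hε0 hδ
  set δ := 1 - ‖w‖ with hδdef
  have hδ0 : 0 < δ := by linarith
  set F := defect b hb (HardySpace.szego w hw) with hF
  have h1 := mul_potential_le_dirichletIntegral μ F.differentiableOn
    (by positivity : 0 < 8 / ε) hw hz hzw
  have h2 := hC (CFC.sqrt (defect b hb) (HardySpace.szego w hw))
  rw [sqrt_defect_sqrt_defect, norm_sqrt_defect_szego_sq] at h2
  have h3 : C * ((1 - ‖b w‖ ^ 2) * (1 - ‖w‖ ^ 2)⁻¹) ≤ |C| / δ := by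
    rw [← div_eq_mul_inv, ← mul_div_assoc]
    have h0 := norm_nonneg w
    refine div_le_div₀ (abs_nonneg _) ?_ hδ0 (by nlinarith)
    refine (mul_le_mul_of_nonneg_right (le_abs_self C) (by linarith)).trans ?_
    exact mul_le_of_le_one_right (abs_nonneg _) (by nlinarith [sq_nonneg ‖b w‖])
  have h4 : κ / δ ≤ δ ^ 3 / (8 * (8 / ε + 2) ^ 2) * ‖deriv F.toFun z‖ ^ 2 := by
    calc κ / δ = δ ^ 3 / (8 * (8 / ε + 2) ^ 2) * (ε ^ 2 / 64 / δ ^ 2) ^ 2 := by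
          rw [hκ]; field_simp
      _ ≤ _ := by gcongr
  have h5 : ENNReal.ofReal (κ / δ) * potential μ w ≤ ENNReal.ofReal (|C| / δ) :=
    (mul_le_mul_left (ENNReal.ofReal_le_ofReal h4) _).trans
      (h1.trans (h2.trans (ENNReal.ofReal_le_ofReal h3)))
  have h6 : |C| / κ = (|C| / δ) / (κ / δ) := by field_simp
  rw [h6, ENNReal.ofReal_div_of_pos (by positivity)]
  refine (ENNReal.le_div_iff_mul_le (Or.inl ?_) (Or.inl ENNReal.ofReal_ne_top)).2 ?_
  · simpa using div_pos hκ0 hδ0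
  · rwa [mul_comm]

/-- For some `c < 1`, `|b| < c` holds at points of the disk arbitrarily near `ζ`, so the uniform
bound with `ε = 1 - c²` applies there. -/
theorem potential_lt_top_of_mem_boundarySpectrum {μ : Measure (sphere (0 : ℂ) 1)} [SFinite μ]
    {b : ℂ → ℂ} (hb : InUnitBall b) (hsub : deBrangesRovnyak b hb ⊆ dirichletSpace μ)
    {ζ : sphere (0 : ℂ) 1} (hζ : ζ ∈ boundarySpectrum b) : potential μ (ζ : ℂ) < ∞ := by
  obtain ⟨c, hc, hc1⟩ := exists_between (show _ < (1 : ℝ≥0∞) from hζ)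
  lift c to NNReal using hc1.ne_top
  have hc1' : (c : ℝ) < 1 := by exact_mod_cast hc1
  have hfreq := frequently_lt_of_liminf_lt (by isBoundedDefault) hc
  set ε : ℝ := 1 - (c : ℝ) ^ 2 with hε
  have hε0 : 0 < ε := by nlinarith [c.coe_nonneg]
  obtain ⟨C, hC⟩ := exists_potential_le hb hsub hε0
  refine lt_of_le_of_lt (potential_le_of_frequently (s := ball 0 1)
    (C := ENNReal.ofReal C) ?_) ENNReal.ofReal_lt_top
  have hev : ∀ᶠ z : ℂ in 𝓝[ball 0 1] (ζ : ℂ), 8 / ε * (1 - ‖z‖) ≤ 1 := by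
    refine Filter.Eventually.filter_mono nhdsWithin_le_nhds ?_
    have hcont : Continuous fun z : ℂ => 8 / ε * (1 - ‖z‖) := by fun_prop
    have hlt : 8 / ε * (1 - ‖(ζ : ℂ)‖) < 1 := by simp
    exact (hcont.continuousAt.eventually_lt_const hlt).mono fun _ h => h.le
  refine (hfreq.and_eventually (hev.and self_mem_nhdsWithin)).mono ?_
  rintro z ⟨hz, hz1, hzball⟩
  refine hC z (by simpa using hzball) ?_ hz1
  have hz' : ‖b z‖ < c := by
    have : ‖b z‖₊ < c := by exact_mod_cast hz
    exact_mod_cast this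
  rw [hε]
  gcongr

end HardyDirichlet

theorem mainTheorem5
    (μ : MeasureTheory.Measure (Metric.sphere (0 : ℂ) 1)) [MeasureTheory.IsFiniteMeasure μ]
    (b : ℂ → ℂ) (hb : HardyDirichlet.InUnitBall b)
    (hsub : HardyDirichlet.deBrangesRovnyak b hb ⊆ HardyDirichlet.dirichletSpace μ) :
    (∀ ζ ∈ HardyDirichlet.boundarySpectrum b, HardyDirichlet.potential μ (ζ : ℂ) < ⊤) ∧
      μ (HardyDirichlet.boundarySpectrum b) = 0 := by
  have h : ∀ ζ ∈ HardyDirichlet.boundarySpectrum b, HardyDirichlet.potential μ (ζ : ℂ) < ⊤ :=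
    fun ζ hζ => HardyDirichlet.potential_lt_top_of_mem_boundarySpectrum hb hsub hζ
  exact ⟨h, HardyDirichlet.measure_eq_zero_of_potential_lt_top h⟩
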